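/- Let $K$ be an algebraically closed field of characteristic $0$, let $d \ge 1$ and $1 \le n \le d+1$, let $R = K[x_0,\dots,x_d]$ be the homogeneous coordinate ring of $\mathbb{P}^d$ over $K$, and let $M = (x_0,\dots,x_d)$. For a point $P \in \mathbb{P}^d$ let $I(P) \subset R$ be the ideal generated by all forms vanishing at $P$. For an ideal $I \subset R$ and $m \ge 1$, let the symbolic power $I^{(m)}$ be the intersection, over all associated primes $\mathfrak p$ of $I$, of the ideals $I^m R_{\mathfrak p} \cap R$ (so if $I = \bigcap_j I(P_j)$ for finitely many points $P_j$, then $I^{(m)} = \bigcap_j I(P_j)^m$). Let $P_1,\dots,P_n$ be $n$ general points of $\mathbb{P}^d$, and let $I = I(P_1) \cap \dots \cap I(P_n)$. Then for all $r \ge 1$: (a) $I^{(rd)} \subseteq M^{r(d-1)} I^r$, and (b) $I^{(rd-(d-1))} \subseteq M^{(r-1)(d-1)} I^r$. Here "general" means that there is a nonempty Zariski open subset $U$ of $(\mathbb{P}^d)^n$, depending only on $K$, $d$ and $n$ (not on $r$), such that for every $(P_1,\dots,P_n) \in U$ the points $P_1,\dots,P_n$ are distinct and (a) and (b) hold for all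 $r \ge 1$. -/

import Mathlib

open scoped LinearAlgebra.Projectivization

noncomputable section

namespace GeneralPoints

/-- The `m`-th symbolic power `I^{(m)}` of an ideal `I` of `R`: the intersection, over the associated
primes `p` of `I` (that is, of `R ⧸ I`), of the contractions to `R` of `I ^ m R_p`. In a Noetherian
ring it is the intersection of the primary components of `I ^ m` whose radicals are contained in
some associated prime of `I`. -/
def symbolicPower {R : Type*} [CommRing R] (I : Ideal R) (m : ℕ) : Ideal R :=
  ⨅ p : {p : Ideal R // p ∈ associatedPrimes R (R ⧸ I)},
    haveI : p.1.IsPrime := p.2.1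
    ((I ^ m).map (algebraMap R (Localization.AtPrime p.1))).comap
      (algebraMap R (Localization.AtPrime p.1))

/-- The projective space `ℙ^d` over `K`, as the set of lines through the origin of `K^{d+1}`. -/
abbrev ProjSpace (K : Type*) [Field K] (d : ℕ) : Type _ := ℙ K (Fin (d + 1) → K)

/-- The homogeneous coordinate ring `K[x_0, …, x_d]` of `ℙ^d`. -/
abbrev CoordRing (K : Type*) [Field K] (d : ℕ) : Type _ := MvPolynomial (Fin (d + 1)) K

/-- The irrelevant ideal `M = (x_0, …, x_d)`. -/
def irrelevantIdeal (K : Type*) [Field K] (d : ℕ) : Ideal (CoordRing K d) :=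
  Ideal.span (Set.range (MvPolynomial.X : Fin (d + 1) → CoordRing K d))

/-- The ideal `I(P)` generated by all forms that vanish at the point `P`. For a form, vanishing at
the chosen representative of `P` is the same as vanishing at any other one. -/
def pointIdeal {K : Type*} [Field K] {d : ℕ} (P : ProjSpace K d) : Ideal (CoordRing K d) :=
  Ideal.span {f | (∃ k : ℕ, f.IsHomogeneous k) ∧ MvPolynomial.eval P.rep f = 0}

/-- The ideal `I(Z) = ⋂ j, I(P_j)` of `Z = P_1 + ⋯ + P_n`. -/
def pointsIdeal {K : Type*} [Field K] {d n : ℕ} (P : Fin n → ProjSpace K d) :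
    Ideal (CoordRing K d) :=
  ⨅ j, pointIdeal (P j)

/-- A polynomial in the coordinates `x_{i,j}` of `(ℙ^d)^n` (the index `i` is the factor, `j` the
coordinate) is multihomogeneous of multidegree `e` if for every `i` each of its monomials has degree
`e i` in the variables `x_{i,0}, …, x_{i,d}`. -/
def IsMultihomogeneous {K : Type*} [Field K] {d n : ℕ}
    (f : MvPolynomial (Fin n × Fin (d + 1)) K) (e : Fin n → ℕ) : Prop :=
  ∀ u ∈ f.support, ∀ i, ∑ j, u (i, j) = e i

/-- The common zeros in `(ℙ^d)^n` of a set of multihomogeneous polynomials. -/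
def zeroLocus {K : Type*} [Field K] {d n : ℕ}
    (S : Set (MvPolynomial (Fin n × Fin (d + 1)) K)) : Set (Fin n → ProjSpace K d) :=
  {P | ∀ f ∈ S, MvPolynomial.eval (fun ij => (P ij.1).rep ij.2) f = 0}

/-- Zariski open subsets of `(ℙ^d)^n`: complements of the zero loci of sets of multihomogeneous
polynomials. -/
def IsZariskiOpen {K : Type*} [Field K] {d n : ℕ} (U : Set (Fin n → ProjSpace K d)) : Prop :=
  ∃ S : Set (MvPolynomial (Fin n × Fin (d + 1)) K),
    (∀ f ∈ S, ∃ e, IsMultihomogeneous f e) ∧ U = (zeroLocus S)ᶜ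

/-- The property `Q` holds for `n` general points of `ℙ^d`: it holds for all `(P_1, …, P_n)` in some
nonempty Zariski open subset of the (irreducible) variety `(ℙ^d)^n`. -/
def HoldsForGeneralPoints (K : Type*) [Field K] (d n : ℕ)
    (Q : (Fin n → ProjSpace K d) → Prop) : Prop :=
  ∃ U : Set (Fin n → ProjSpace K d), IsZariskiOpen U ∧ U.Nonempty ∧ ∀ P ∈ U, Q P

end GeneralPoints

end

/-! At most d + 1 general points are linearly independent, so a linear change of coordinates turns
them into coordinate points. Their ideals p_j, and the intersection I, are then monomial. Powers of
p_j are primary, so I^(m) lies in the intersection of the p_j^m. A monomial of an element of that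
intersection has degree at least m in the variables other than the one belonging to P_j, for every
j. Conversely I contains each variable vanishing at all the points and each product of two distinct
variables. The theorem becomes a count: how many such factors can be split off a monomial
(`monomial_mem_pow_mul_pow`)? Both (a) and (b) are cases of I^(m) ⊆ M^(m-r) I^r for m ≥ r and m ≥
d(r-1) + 1 (`symbolicPower_pointsIdeal_le`). The open set is the nonvanishing of a single minor, so
it does not depend on r. -/

noncomputable section

namespace GeneralPoints

open MvPolynomial

/-! ### Symbolic powers of an intersection of primes -/

section SymbolicPower

variable {R : Type*} [CommRing R] {n : ℕ}

/-- A symbolic power of an intersection of primes lies in the intersection of the ordinary powers,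
provided that these powers are primary and that no prime contains the intersection of the others. -/
theorem symbolicPower_iInf_le (p : Fin n → Ideal R) (hp : ∀ j, (p j).IsPrime)
    (hprim : ∀ j m g h, g ∉ p j → g * h ∈ p j ^ m → h ∈ p j ^ m)
    (hsep : ∀ j, ∃ f, f ∉ p j ∧ ∀ k, k ≠ j → f ∈ p k) (m : ℕ) :
    symbolicPower (⨅ j, p j) m ≤ ⨅ j, p j ^ m := by
  refine le_iInf fun j => ?_
  have hpj := hp j
  have hass : p j ∈ associatedPrimes R (R ⧸ (⨅ j, p j)) := by
    refine ⟨hpj, ?_⟩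
    obtain ⟨f, hf, hfk⟩ := hsep j
    refine ⟨Ideal.Quotient.mk _ f, ?_⟩
    -- The class of f has annihilator exactly `p j`, which makes `p j` an associated prime.
    have hcolon : Submodule.colon (⊥ : Submodule R (R ⧸ (⨅ j, p j)))
        {Ideal.Quotient.mk (⨅ j, p j) f} = p j := by
      ext g
      rw [Submodule.mem_colon_singleton, Submodule.mem_bot, Algebra.smul_def,
        Ideal.Quotient.algebraMap_eq, ← map_mul, Ideal.Quotient.eq_zero_iff_mem, Ideal.mem_iInf]
      refine ⟨fun h => (hpj.mem_or_mem (h j)).resolve_right hf, fun h k => ?_⟩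
      by_cases hk : k = j
      · subst hk
        exact Ideal.mul_mem_right _ _ h
      · exact Ideal.mul_mem_left _ _ (hfk k hk)
    rw [hcolon, hpj.isRadical.radical]
  intro h hh
  have hh' := (Submodule.mem_iInf _).1 hh ⟨p j, hass⟩
  rw [Ideal.mem_comap,
    IsLocalization.algebraMap_mem_map_algebraMap_iff (p j).primeCompl] at hh'
  obtain ⟨g, hg, hgh⟩ := hh'
  exact hprim j m g h hg (Ideal.pow_right_mono (iInf_le p j) m hgh)

end SymbolicPower

/-! ### Coordinate points and monomials -/

section CoordinatePoints

variable {K : Type*} [Field K] {σ : Type*}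

/-- The ideal of the coordinate point whose only nonzero coordinate is the one with index `j`. -/
def coordIdeal (K : Type*) [Field K] {σ : Type*} (j : σ) : Ideal (MvPolynomial σ K) :=
  Ideal.span (X '' {j}ᶜ)

theorem X_mem_coordIdeal {i j : σ} (h : i ≠ j) : (X i : MvPolynomial σ K) ∈ coordIdeal K j :=
  Ideal.subset_span ⟨i, h, rfl⟩

open scoped Classical in
/-- The substitution that multiplies each variable other than `X j` by a new variable. -/
def expand (K : Type*) [Field K] {σ : Type*} (j : σ) :
    MvPolynomial σ K →ₐ[K] Polynomial (MvPolynomial σ K) :=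
  aeval fun i => if i = j then Polynomial.C (X i) else Polynomial.X * Polynomial.C (X i)

/-- The new variable counts the degree in the variables other than `X j`, so its k-th coefficient
lies in the k-th power of the ideal. -/
theorem expand_mem_reesAlgebra (j : σ) (g : MvPolynomial σ K) :
    expand K j g ∈ reesAlgebra (coordIdeal K j) := by
  induction g using MvPolynomial.induction_on with
  | C a =>
    have : expand K j (C a) = algebraMap (MvPolynomial σ K) _ (C a) := by
      simp only [expand, algHom_C]
      rfl
    rw [this]
    exact Subalgebra.algebraMap_mem _ _
  | add p q hp hq => rw [map_add]; exact add_mem hp hq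
  | mul_X p i hp =>
    rw [map_mul]
    refine mul_mem hp ?_
    rw [expand, aeval_X]
    split_ifs with h
    · exact Subalgebra.algebraMap_mem (reesAlgebra (coordIdeal K j)) _
    · rw [Polynomial.X_mul_C, Polynomial.C_mul_X_eq_monomial, reesAlgebra.monomial_mem, pow_one]
      exact X_mem_coordIdeal h

theorem eval_one_expand (j : σ) (g : MvPolynomial σ K) :
    (expand K j g).eval 1 = g := by
  induction g using MvPolynomial.induction_on with
  | C a =>
    simp only [expand, algHom_C]
    exact Polynomial.eval_C
  | add p q hp hq => rw [map_add, Polynomial.eval_add, hp, hq]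
  | mul_X p i hp =>
    rw [map_mul, Polynomial.eval_mul, hp, expand, aeval_X]
    split_ifs <;> simp

/-- Turns membership in powers into divisibility by powers of the prime element `Polynomial.X`. That
the ideal is prime and its powers primary then follows at once. -/
theorem mem_coordIdeal_pow_iff (j : σ) (m : ℕ) (g : MvPolynomial σ K) :
    g ∈ coordIdeal K j ^ m ↔ Polynomial.X ^ m ∣ expand K j g := by
  constructor
  · intro hg
    have hle : coordIdeal K j ≤ (Ideal.span {Polynomial.X}).comap (expand K j) := by
      rw [coordIdeal, Ideal.span_le]
      rintro _ ⟨i, hi, rfl⟩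
      rw [SetLike.mem_coe, Ideal.mem_comap, Ideal.mem_span_singleton, expand, aeval_X,
        if_neg (Set.mem_compl_singleton_iff.1 hi)]
      exact dvd_mul_right _ _
    have := Ideal.le_comap_pow (expand K j) m (Ideal.pow_right_mono hle m hg)
    rwa [Ideal.mem_comap, Ideal.span_singleton_pow, Ideal.mem_span_singleton] at this
  · intro hg
    rw [Polynomial.X_pow_dvd_iff] at hg
    rw [← eval_one_expand j g, Polynomial.eval_eq_sum_range]
    refine sum_mem fun k _ => ?_
    rw [one_pow, mul_one]
    by_cases hk : k < m
    · rw [hg k hk]; exact zero_mem _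
    · exact Ideal.pow_le_pow_right (not_lt.1 hk)
        ((mem_reesAlgebra_iff _ _).1 (expand_mem_reesAlgebra j g) k)

theorem mem_coordIdeal_iff (j : σ) (g : MvPolynomial σ K) :
    g ∈ coordIdeal K j ↔ Polynomial.X ∣ expand K j g := by
  simpa using mem_coordIdeal_pow_iff j 1 g

theorem X_notMem_coordIdeal (j : σ) : (X j : MvPolynomial σ K) ∉ coordIdeal K j := by
  rw [mem_coordIdeal_iff, Polynomial.X_dvd_iff, expand, aeval_X, if_pos rfl, Polynomial.coeff_C_zero]
  exact X_ne_zero j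

theorem coordIdeal_isPrime (j : σ) : (coordIdeal K j).IsPrime where
  ne_top' h := X_notMem_coordIdeal (K := K) j (h ▸ Submodule.mem_top)
  mem_or_mem' {x y} h := by
    simp only [mem_coordIdeal_iff, map_mul] at h ⊢
    exact Polynomial.prime_X.dvd_or_dvd h

theorem mem_coordIdeal_pow_of_mul_mem {j : σ} {m : ℕ} {g h : MvPolynomial σ K}
    (hg : g ∉ coordIdeal K j) (hgh : g * h ∈ coordIdeal K j ^ m) : h ∈ coordIdeal K j ^ m := by
  rw [mem_coordIdeal_iff] at hg
  rw [mem_coordIdeal_pow_iff, map_mul] at hgh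
  rw [mem_coordIdeal_pow_iff]
  exact Polynomial.prime_X.pow_dvd_of_dvd_mul_left _ hg hgh

/-- The power is generated by monomials of degree m in the variables other than `X j`, and multiples
of these keep at least that degree. -/
theorem le_degree_of_mem_coordIdeal_pow {j : σ} {m : ℕ} {g : MvPolynomial σ K}
    (hg : g ∈ coordIdeal K j ^ m) {u : σ →₀ ℕ} (hu : u ∈ g.support) : m + u j ≤ u.degree := by
  have hle : coordIdeal K j ^ m ≤
      Ideal.span ((fun s => monomial s (1 : K)) '' {u | m + u j ≤ u.degree}) := by
    clear hu hg
    induction m with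
    | zero =>
      rw [pow_zero, Ideal.one_eq_top, top_le_iff, Ideal.eq_top_iff_one]
      exact Ideal.subset_span ⟨0, by simp, rfl⟩
    | succ m ih =>
      rw [pow_succ]
      refine (Ideal.mul_mono_left ih).trans ?_
      rw [coordIdeal, Ideal.span_mul_span', Ideal.span_le]
      rintro _ ⟨_, ⟨u, hu, rfl⟩, _, ⟨i, hi, rfl⟩, rfl⟩
      refine Ideal.subset_span ⟨u + Finsupp.single i 1, ?_, ?_⟩
      · have hi' : Finsupp.single i 1 j = 0 := Finsupp.single_eq_of_ne (Ne.symm hi)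
        simp only [Set.mem_ofPred_eq, map_add, Finsupp.degree_single, Finsupp.add_apply, hi'] at hu ⊢
        omega
      · simp [X, monomial_mul]
  obtain ⟨v, hv, hvu⟩ := mem_ideal_span_monomial_image.1 (hle hg) u hu
  obtain ⟨w, rfl⟩ := le_iff_exists_add.1 hvu
  have := Finsupp.le_degree j w
  simp only [Set.mem_ofPred_eq, map_add, Finsupp.add_apply] at hv ⊢
  omega

variable [Fintype σ] [DecidableEq σ]

theorem degree_eq_sum_add_sum_compl (a : σ →₀ ℕ) (T : Finset σ) :
    a.degree = ∑ i ∈ T, a i + ∑ i ∈ Tᶜ, a i := by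
  rw [Finsupp.degree_eq_sum, Finset.sum_add_sum_compl]

theorem exists_two_largest (a : σ →₀ ℕ) (h0 : 0 < a.degree) (h : ∀ j, a j < a.degree) :
    ∃ j k, j ≠ k ∧ 0 < a k ∧ a k ≤ a j ∧ ∀ i, i ≠ j → a i ≤ a k := by
  have hsum (j : σ) : a.degree = a j + ∑ i ∈ Finset.univ.erase j, a i := by
    rw [Finsupp.degree_eq_sum, Finset.add_sum_erase _ _ (Finset.mem_univ j)]
  have hne : (Finset.univ : Finset σ).Nonempty := by
    refine Finset.nonempty_of_sum_ne_zero (f := a) ?_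
    rw [← Finsupp.degree_eq_sum]
    exact h0.ne'
  obtain ⟨j, -, hj⟩ := Finset.exists_max_image Finset.univ a hne
  have hpos : ∑ i ∈ Finset.univ.erase j, a i ≠ 0 := by
    have := hsum j
    have := h j
    omega
  obtain ⟨k, hk, hkmax⟩ := Finset.exists_max_image (Finset.univ.erase j) a
    (Finset.nonempty_of_sum_ne_zero hpos)
  obtain ⟨l, hl, hl0⟩ := Finset.exists_ne_zero_of_sum_ne_zero hpos
  exact ⟨j, k, (Finset.ne_of_mem_erase hk).symm,
    (Nat.pos_of_ne_zero hl0).trans_le (hkmax l hl), hj k (Finset.mem_univ k),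
    fun i hi => hkmax i (Finset.mem_erase.2 ⟨hi, Finset.mem_univ i⟩)⟩

theorem add_add_le_degree (a : σ →₀ ℕ) {i j k : σ} (hij : i ≠ j) (hik : i ≠ k) (hjk : j ≠ k) :
    a i + a j + a k ≤ a.degree := by
  have h := Finset.sum_le_univ_sum_of_nonneg (f := a) (s := {i, j, k}) fun _ => Nat.zero_le _
  rw [Finset.sum_insert (by simp [hij, hik]), Finset.sum_insert (by simp [hjk]),
    Finset.sum_singleton, ← Finsupp.degree_eq_sum] at h
  omega

/-- A monomial of sufficiently large degree is divisible by a product of `r` generators, each of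
them a variable with index outside `T` or a product of two distinct variables. -/
theorem monomial_mem_pow_mul_pow (J : Ideal (MvPolynomial σ K)) (T : Finset σ)
    (hlin : ∀ i ∉ T, X i ∈ J) (hquad : ∀ i k, i ≠ k → X i * X k ∈ J) (r t : ℕ) (a : σ →₀ ℕ)
    (h1 : ∀ j ∈ T, r + a j ≤ a.degree) (h2 : 2 * r + t ≤ a.degree + ∑ i ∈ Tᶜ, a i)
    (h3 : r + t ≤ a.degree) :
    monomial a (1 : K) ∈ idealOfVars σ K ^ t * J ^ r := by
  induction r generalizing a with
  | zero =>
    rw [pow_zero, mul_one, monomial_mem_pow_idealOfVars_iff _ _ one_ne_zero]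
    omega
  | succ r ih =>
    rw [pow_succ, ← mul_assoc]
    by_cases hs : ∃ i ∉ T, a i ≠ 0
    -- A variable outside `T` is a generator by itself. Removing it lowers both sides of `h2` by 2.
    · obtain ⟨i, hi, hai⟩ := hs
      obtain ⟨b, rfl⟩ : ∃ b, a = b + Finsupp.single i 1 :=
        le_iff_exists_add'.1 (Finsupp.single_le_iff.2 (Nat.pos_of_ne_zero hai))
      have hsingle : ∑ l ∈ Tᶜ, Finsupp.single i 1 l = 1 := by
        simp [Finsupp.single_apply, hi]
      simp only [map_add, Finsupp.degree_single, Finsupp.add_apply, Finset.sum_add_distrib,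
        hsingle] at h1 h2 h3
      rw [show monomial (b + Finsupp.single i 1) (1 : K) = monomial b 1 * X i by
        simp [X, monomial_mul]]
      refine Ideal.mul_mem_mul (ih b (fun j hj => ?_) (by omega) (by omega)) (hlin i hi)
      have := h1 j hj
      omega
    · push Not at hs
      rw [Finset.sum_eq_zero fun i hi => hs i (Finset.mem_compl.1 hi)] at h2
      -- Only variables in `T` remain. Removing the two with the largest exponents preserves `h1`,
      -- as the degree drops by 2.
      obtain ⟨j, k, hjk, hk0, hkj, hmax⟩ := exists_two_largest a (by omega) fun j => by
        by_cases hj : j ∈ T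
        · have := h1 j hj
          omega
        · have := hs j hj
          omega
      -- An exponent that is not lowered is at most a third of the degree, and `h2` bounds r + 1 by
      -- half of it.
      have h4 : ∀ i ∈ T, i ≠ j → i ≠ k → a i + r + 2 ≤ a.degree := fun i _ hij hik => by
        have := add_add_le_degree a hij hik hjk
        have := hmax i hij
        omega
      obtain ⟨b, rfl⟩ : ∃ b, a = b + Finsupp.single j 1 :=
        le_iff_exists_add'.1 (Finsupp.single_le_iff.2 (by omega))
      obtain ⟨b, rfl⟩ : ∃ b', b = b' + Finsupp.single k 1 := by
        refine le_iff_exists_add'.1 (Finsupp.single_le_iff.2 ?_)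
        rw [Finsupp.add_apply, Finsupp.single_eq_of_ne hjk.symm] at hk0
        omega
      simp only [map_add, Finsupp.degree_single, Finsupp.add_apply] at h1 h2 h3 h4
      rw [show monomial (b + Finsupp.single k 1 + Finsupp.single j 1) (1 : K) =
        monomial b 1 * (X k * X j) by simp [X, monomial_mul, add_assoc]]
      refine Ideal.mul_mem_mul (ih b (fun i hi => ?_) (by omega) (by omega)) (hquad k j hjk.symm)
      by_cases hij : i = j
      · subst hij
        have := h1 i hi
        rw [Finsupp.single_eq_same] at this
        omega
      · by_cases hik : i = k
        · subst hik
          have := h1 i hi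
          rw [Finsupp.single_eq_same] at this
          omega
        · have := h4 i hi hij hik
          omega

theorem iInf_coordIdeal_pow_le {d n : ℕ} (hd : 1 ≤ d) (hn : 1 ≤ n) (hnd : n ≤ d + 1)
    (c : Fin n → σ) (hc : Function.Injective c) {m r : ℕ} (hr : r ≤ m) (hm : d * r + 1 ≤ m + d) :
    ⨅ j, coordIdeal K (c j) ^ m ≤ idealOfVars σ K ^ (m - r) * (⨅ j, coordIdeal K (c j)) ^ r := by
  intro g hg
  rw [g.as_sum]
  refine sum_mem fun a ha => ?_
  have hle (j : Fin n) : m + a (c j) ≤ a.degree :=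
    le_degree_of_mem_coordIdeal_pow ((Submodule.mem_iInf _).1 hg j) ha
  rw [← mul_one (coeff a g), ← C_mul_monomial]
  have hma : m ≤ a.degree := (Nat.le_add_right _ _).trans (hle ⟨0, hn⟩)
  have hsplit : a.degree = ∑ j, a (c j) + ∑ i ∈ (Finset.univ.image c)ᶜ, a i := by
    rw [degree_eq_sum_add_sum_compl a (Finset.univ.image c), Finset.sum_image hc.injOn]
  have hsum : n * m + ∑ j, a (c j) ≤ n * a.degree := by
    simpa [Finset.sum_add_distrib] using Finset.sum_le_sum fun j (_ : j ∈ Finset.univ) => hle j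
  refine Ideal.mul_mem_left _ _ (monomial_mem_pow_mul_pow _ (Finset.univ.image c) ?_ ?_ _ _ _
    ?_ ?_ ?_)
  · intro i hi
    rw [Submodule.mem_iInf]
    refine fun j => X_mem_coordIdeal fun h => hi ?_
    rw [h]
    exact Finset.mem_image_of_mem c (Finset.mem_univ j)
  · intro i k hik
    rw [Submodule.mem_iInf]
    intro j
    by_cases hi : i = c j
    · exact Ideal.mul_mem_left _ _ (X_mem_coordIdeal (hi ▸ hik.symm))
    · exact Ideal.mul_mem_right _ _ (X_mem_coordIdeal hi)
  · intro j hj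
    obtain ⟨j, -, rfl⟩ := Finset.mem_image.1 hj
    have := hle j
    omega
  -- With degree m + x, the claim is r ≤ x + s. Summing the n degree conditions gives m ≤ d x + s,
  -- while r > x + s would force m ≥ d (x + s) + 1.
  · obtain ⟨x, hx⟩ := Nat.exists_eq_add_of_le hma
    generalize ∑ j, a (c j) = B at *
    generalize ∑ i ∈ (Finset.univ.image c)ᶜ, a i = s at *
    have h5 : m ≤ d * x + s := by
      have : n * x ≤ (d + 1) * x := Nat.mul_le_mul_right _ hnd
      rw [hx] at hsum hsplit
      nlinarith
    have : r ≤ x + s := by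
      by_contra hlt
      obtain ⟨y, hy⟩ := Nat.exists_eq_add_of_lt (not_le.1 hlt)
      have : s ≤ d * s := Nat.le_mul_of_pos_left _ hd
      subst hy
      nlinarith [Nat.zero_le (d * y)]
    omega
  · omega

end CoordinatePoints

/-! ### Linear changes of coordinates -/

section LinearSubstitution

variable {K : Type*} [Field K] {σ : Type*} [Fintype σ]

/-- The substitution `x_i ↦ ∑ k, A i k * x_k`. -/
def linSubst (A : Matrix σ σ K) : MvPolynomial σ K →ₐ[K] MvPolynomial σ K :=
  aeval fun i => ∑ k, C (A i k) * X k

theorem linSubst_X (A : Matrix σ σ K) (i : σ) : linSubst A (X i) = ∑ k, C (A i k) * X k :=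
  aeval_X _ _

theorem linSubst_linSubst [DecidableEq σ] {A B : Matrix σ σ K} (h : B * A = 1)
    (f : MvPolynomial σ K) : linSubst A (linSubst B f) = f := by
  suffices (linSubst A).comp (linSubst B) = AlgHom.id K _ from DFunLike.congr_fun this f
  refine algHom_ext fun i => ?_
  simp only [AlgHom.comp_apply, linSubst_X, map_sum, map_mul, AlgHom.id_apply, Finset.mul_sum]
  rw [Finset.sum_comm]
  have hC (l : σ) : ∑ k, C (B i k) * (C (A k l) * X l) =
      (C ((1 : Matrix σ σ K) i l) * X l : MvPolynomial σ K) := by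
    rw [← h, Matrix.mul_apply, map_sum, Finset.sum_mul]
    simp [mul_assoc]
  simp only [linSubst, algHom_C, algebraMap_eq, hC]
  simp [Matrix.one_apply]

theorem eval_linSubst (A : Matrix σ σ K) (v : σ → K) (f : MvPolynomial σ K) :
    eval v (linSubst A f) = eval (A.mulVec v) f := by
  induction f using MvPolynomial.induction_on with
  | C a => simp [linSubst]
  | add p q hp hq => rw [map_add, map_add, map_add, hp, hq]
  | mul_X p i hp => simp [hp, linSubst_X, Matrix.mulVec, dotProduct]

theorem isHomogeneous_linSubst (A : Matrix σ σ K) {f : MvPolynomial σ K} {t : ℕ}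
    (hf : f.IsHomogeneous t) : (linSubst A f).IsHomogeneous t := by
  rw [← one_mul t]
  exact hf.aeval _ fun i => IsHomogeneous.sum _ _ _ fun k _ => (isHomogeneous_X K k).C_mul _

theorem idealOfVars_le_comap_linSubst (A : Matrix σ σ K) :
    idealOfVars σ K ≤ (idealOfVars σ K).comap (linSubst A) := by
  rw [Ideal.span_le]
  rintro _ ⟨i, rfl⟩
  rw [SetLike.mem_coe, Ideal.mem_comap, linSubst_X]
  exact sum_mem fun k _ => Ideal.mul_mem_left _ _ (Ideal.subset_span ⟨k, rfl⟩)

/-- The value of a form of degree t at the coordinate point is its coefficient of `X j ^ t`, the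
only monomial of that degree outside the ideal. -/
theorem mem_coordIdeal_of_eval_eq_zero [DecidableEq σ] {f : MvPolynomial σ K} {t : ℕ}
    (hf : f.IsHomogeneous t) {j : σ} (h0 : eval (Pi.single j 1) f = 0) : f ∈ coordIdeal K j := by
  rw [coordIdeal, mem_ideal_span_X_image]
  intro u hu
  by_contra! hne
  have hsupp : ∀ v ∈ f.support, v ≠ u → ∃ i, i ≠ j ∧ v i ≠ 0 := by
    intro v hv hvu
    by_contra! hv0
    have hdeg {w : σ →₀ ℕ} (hw : w ∈ f.support) (hw0 : ∀ i, i ≠ j → w i = 0) : w j = t := by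
      have := hf (mem_support_iff.1 hw)
      rwa [show Finsupp.weight 1 w = w.degree from
        (DFunLike.congr_fun Finsupp.degree_eq_weight_one w).symm, Finsupp.degree_eq_sum, Finset.sum_eq_single j (fun i _ hi => hw0 i hi) (by simp)] at this
    refine hvu (Finsupp.ext fun i => ?_)
    by_cases hi : i = j
    · rw [hi, hdeg hv hv0, hdeg hu fun i hi => hne i hi]
    · rw [hv0 i hi, hne i hi]
  rw [eval_eq', Finset.sum_eq_single u] at h0
  · rw [Finset.prod_eq_one, mul_one] at h0
    · exact mem_support_iff.1 hu h0
    · intro i _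
      by_cases hi : i = j
      · rw [hi, Pi.single_eq_same, one_pow]
      · rw [hne i hi, pow_zero]
  · intro v hv hvu
    obtain ⟨i, hi, hvi⟩ := hsupp v hv hvu
    rw [Finset.prod_eq_zero (Finset.mem_univ i), mul_zero]
    rw [Pi.single_eq_of_ne hi, zero_pow hvi]
  · exact fun h => absurd hu h

end LinearSubstitution

/-! ### Linearly independent points -/

section IndependentPoints

variable {K : Type*} [Field K] {d : ℕ}

theorem pointIdeal_eq_comap {A B : Matrix (Fin (d + 1)) (Fin (d + 1)) K} (hAB : A * B = 1)
    (hBA : B * A = 1) {P : ProjSpace K d} {k : Fin (d + 1)}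
    (hP : A.mulVec (Pi.single k 1) = P.rep) :
    pointIdeal P = (coordIdeal K k).comap (linSubst A) := by
  apply le_antisymm
  · rw [pointIdeal, Ideal.span_le]
    rintro f ⟨⟨t, ht⟩, hf⟩
    refine mem_coordIdeal_of_eval_eq_zero (isHomogeneous_linSubst A ht) ?_
    rw [eval_linSubst, hP, hf]
  · have hle : coordIdeal K k ≤ (pointIdeal P).comap (linSubst B) := by
      rw [coordIdeal, Ideal.span_le]
      rintro _ ⟨i, hi, rfl⟩
      refine Ideal.subset_span ⟨⟨1, isHomogeneous_linSubst B (isHomogeneous_X K i)⟩, ?_⟩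
      rw [eval_linSubst, ← hP, Matrix.mulVec_mulVec, hBA, Matrix.one_mulVec, eval_X,
        Pi.single_eq_of_ne (Set.mem_compl_singleton_iff.1 hi)]
    intro f hf
    have := hle hf
    rwa [Ideal.mem_comap, linSubst_linSubst hAB] at this

theorem exists_matrix_of_linearIndependent {n : ℕ} {v : Fin n → Fin (d + 1) → K}
    (hv : LinearIndependent K v) :
    ∃ (A B : Matrix (Fin (d + 1)) (Fin (d + 1)) K) (c : Fin n → Fin (d + 1)),
      A * B = 1 ∧ B * A = 1 ∧ Function.Injective c ∧
        ∀ j, A.mulVec (Pi.single (c j) 1) = v j := by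
  have hr := hv.linearIndepOn_id
  let b := Module.Basis.extend hr
  let e := b.indexEquiv (Pi.basisFun K (Fin (d + 1)))
  have hmem (j : Fin n) : v j ∈ hr.extend (Set.subset_univ _) :=
    hr.subset_extend _ (Set.mem_range_self j)
  -- The columns of A form a basis extending v, and c records which column is `v j`.
  refine ⟨(Pi.basisFun K _).toMatrix (b.reindex e), (b.reindex e).toMatrix (Pi.basisFun K _),
    fun j => e ⟨v j, hmem j⟩,
    Module.Basis.toMatrix_mul_toMatrix_flip _ _, Module.Basis.toMatrix_mul_toMatrix_flip _ _,
    fun j k h => hv.injective (congrArg Subtype.val (e.injective h)), fun j => ?_⟩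
  ext i
  simp only [Matrix.mulVec_single_one, Matrix.col_apply, Module.Basis.toMatrix_apply,
    Pi.basisFun_repr, Module.Basis.reindex_apply, Equiv.symm_apply_apply]
  exact congrFun (Module.Basis.extend_apply_self hr _) i

theorem symbolicPower_pointsIdeal_le {n : ℕ} (hd : 1 ≤ d) (hn : 1 ≤ n) (hnd : n ≤ d + 1)
    {P : Fin n → ProjSpace K d} (hP : LinearIndependent K fun j => (P j).rep) {m r : ℕ}
    (hr : r ≤ m) (hm : d * r + 1 ≤ m + d) :
    symbolicPower (pointsIdeal P) m ≤ irrelevantIdeal K d ^ (m - r) * pointsIdeal P ^ r := by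
  obtain ⟨A, B, c, hAB, hBA, hc, hAc⟩ := exists_matrix_of_linearIndependent hP
  have hI (j : Fin n) : pointIdeal (P j) = (coordIdeal K (c j)).comap (linSubst A) :=
    pointIdeal_eq_comap hAB hBA (hAc j)
  have hA (j : Fin n) (k : ℕ) :
      pointIdeal (P j) ^ k ≤ (coordIdeal K (c j) ^ k).comap (linSubst A) := by
    rw [hI j]
    exact Ideal.le_comap_pow _ _
  have hcoord (j : Fin n) : coordIdeal K (c j) ≤ (pointIdeal (P j)).comap (linSubst B) := by
    intro f hf
    rw [hI j, Ideal.mem_comap, Ideal.mem_comap]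
    exact (linSubst_linSubst hBA f).symm ▸ hf
  have hB (j : Fin n) (k : ℕ) :
      coordIdeal K (c j) ^ k ≤ (pointIdeal (P j) ^ k).comap (linSubst B) :=
    (Ideal.pow_right_mono (hcoord j) k).trans (Ideal.le_comap_pow _ _)
  have hAB' := linSubst_linSubst hAB
  have hBA' := linSubst_linSubst hBA
  have hpow : symbolicPower (pointsIdeal P) m ≤ ⨅ j, pointIdeal (P j) ^ m := by
    refine symbolicPower_iInf_le _ (fun j => ?_) (fun j k f g hf hfg => ?_) (fun j => ?_) m
    · rw [hI j]
      have := coordIdeal_isPrime (K := K) (c j)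
      exact Ideal.comap_isPrime _ _
    · rw [hI j] at hf
      have hfg' := hA j k hfg
      rw [Ideal.mem_comap, map_mul] at hfg'
      have := hB j k (mem_coordIdeal_pow_of_mul_mem hf hfg')
      rwa [Ideal.mem_comap, hAB'] at this
    -- The linear form that becomes `X (c j)` vanishes at every point except the j-th.
    · refine ⟨linSubst B (X (c j)), ?_, fun k hk => ?_⟩
      · rw [hI j, Ideal.mem_comap, hBA']
        exact X_notMem_coordIdeal _
      · exact hcoord k (X_mem_coordIdeal (hc.ne hk.symm))
  intro f hf
  have hAf : linSubst A f ∈ ⨅ j, coordIdeal K (c j) ^ m :=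
    (Submodule.mem_iInf _).2 fun j => hA j m ((Submodule.mem_iInf _).1 (hpow hf) j)
  have hle : idealOfVars (Fin (d + 1)) K ^ (m - r) * (⨅ j, coordIdeal K (c j)) ^ r ≤
      (irrelevantIdeal K d ^ (m - r) * pointsIdeal P ^ r).comap (linSubst B) := by
    refine (Ideal.mul_mono ?_ ?_).trans (Ideal.le_comap_mul _)
    · exact (Ideal.pow_right_mono (idealOfVars_le_comap_linSubst B) _).trans (Ideal.le_comap_pow _ _)
    · refine (Ideal.pow_right_mono ?_ _).trans (Ideal.le_comap_pow _ _)
      rw [pointsIdeal, Ideal.comap_iInf]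
      exact iInf_mono hcoord
  have := hle (iInf_coordIdeal_pow_le hd hn hnd c hc hr hm hAf)
  rwa [Ideal.mem_comap, hAB'] at this

end IndependentPoints

/-! ### Independence as a nonempty open condition -/

section GenericIndependence

variable {K : Type*} [Field K] {d n : ℕ}

/-- The minor of the first `n` columns of the matrix of coordinates of `n` points of `ℙ^d`. -/
def firstMinor (K : Type*) [Field K] {d n : ℕ} (hnd : n ≤ d + 1) :
    MvPolynomial (Fin n × Fin (d + 1)) K :=
  (Matrix.of fun i k : Fin n => X (i, Fin.castLE hnd k)).det

theorem isMultihomogeneous_firstMinor (hnd : n ≤ d + 1) :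
    IsMultihomogeneous (firstMinor K hnd) fun _ => 1 := by
  classical
  intro u hu i
  rw [firstMinor, Matrix.det_apply'] at hu
  obtain ⟨τ, -, hτ⟩ := Finset.mem_biUnion.1 (support_sum hu)
  have hmon : (∏ l, (X (τ l, Fin.castLE hnd l) : MvPolynomial (Fin n × Fin (d + 1)) K)) =
      monomial (∑ l, Finsupp.single (τ l, Fin.castLE hnd l) 1) 1 := by
    rw [monomial_sum_one]
    rfl
  simp only [Matrix.of_apply] at hτ
  rw [hmon, ← map_intCast (C : K →+* MvPolynomial (Fin n × Fin (d + 1)) K), C_mul_monomial] at hτ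
  rw [Finset.mem_singleton.1 (support_monomial_subset hτ)]
  simp only [Finsupp.finsetSum_apply, Finsupp.single_apply, Prod.mk.injEq]
  rw [Finset.sum_comm, Finset.sum_eq_single (τ.symm i)]
  · simp
  · intro l _ hl
    refine Finset.sum_eq_zero fun k _ => if_neg fun h => hl ?_
    rw [← h.1, Equiv.symm_apply_apply]
  · simp

theorem eval_firstMinor (hnd : n ≤ d + 1) (v : Fin n → Fin (d + 1) → K) :
    eval (fun ij => v ij.1 ij.2) (firstMinor K hnd) =
      (Matrix.of fun i k : Fin n => v i (Fin.castLE hnd k)).det := by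
  rw [firstMinor, RingHom.map_det]
  congr 1
  ext i k
  simp

theorem linearIndependent_of_firstMinor_ne_zero (hnd : n ≤ d + 1) (v : Fin n → Fin (d + 1) → K)
    (h : eval (fun ij => v ij.1 ij.2) (firstMinor K hnd) ≠ 0) : LinearIndependent K v := by
  rw [eval_firstMinor] at h
  exact (Matrix.linearIndependent_rows_of_det_ne_zero h).of_comp
    (LinearMap.funLeft K K (Fin.castLE hnd))

theorem exists_firstMinor_ne_zero (hnd : n ≤ d + 1) :
    ∃ P : Fin n → ProjSpace K d,
      eval (fun ij => (P ij.1).rep ij.2) (firstMinor K hnd) ≠ 0 := by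
  have hne (i : Fin n) : (Pi.single (Fin.castLE hnd i) 1 : Fin (d + 1) → K) ≠ 0 := by
    simp
  refine ⟨fun i => Projectivization.mk K _ (hne i), ?_⟩
  choose a ha using fun i => Projectivization.exists_smul_eq_mk_rep K _ (hne i)
  rw [eval_firstMinor hnd fun i => (Projectivization.mk K _ (hne i)).rep]
  -- The chosen representatives of the coordinate points are unit multiples of the basis vectors, so
  -- the minor is a product of units.
  have : (Matrix.of fun i k : Fin n =>
      (Projectivization.mk K _ (hne i)).rep (Fin.castLE hnd k)) =
      Matrix.diagonal fun i => (a i : K) := by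
    ext i k
    rw [Matrix.of_apply, ← ha i]
    by_cases h : i = k
    · subst h
      simp [Units.smul_def]
    · rw [Matrix.diagonal_apply_ne _ h, Pi.smul_apply, Pi.single_eq_of_ne, smul_zero]
      exact fun h' => h ((Fin.castLE_injective hnd h').symm)
  rw [this, Matrix.det_diagonal]
  exact Finset.prod_ne_zero_iff.2 fun i _ => (a i).ne_zero

end GenericIndependence

end GeneralPoints


end

theorem mainTheorem3 (K : Type*) [Field K] [IsAlgClosed K] [CharZero K]
    (d n : ℕ) (hd : 1 ≤ d) (hn : 1 ≤ n) (hnd : n ≤ d + 1) :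
    GeneralPoints.HoldsForGeneralPoints K d n fun P =>
      Function.Injective P ∧
      ∀ r : ℕ, 1 ≤ r →
        GeneralPoints.symbolicPower (GeneralPoints.pointsIdeal P) (r * d) ≤
            GeneralPoints.irrelevantIdeal K d ^ (r * (d - 1)) *
              GeneralPoints.pointsIdeal P ^ r ∧
          GeneralPoints.symbolicPower (GeneralPoints.pointsIdeal P) (r * d - (d - 1)) ≤
            GeneralPoints.irrelevantIdeal K d ^ ((r - 1) * (d - 1)) *
              GeneralPoints.pointsIdeal P ^ r := by
  refine ⟨(GeneralPoints.zeroLocus {GeneralPoints.firstMinor K hnd})ᶜ, ⟨_, ?_, rfl⟩, ?_, ?_⟩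
  · rintro _ rfl
    exact ⟨_, GeneralPoints.isMultihomogeneous_firstMinor hnd⟩
  · obtain ⟨P, hP⟩ := GeneralPoints.exists_firstMinor_ne_zero (K := K) hnd
    exact ⟨P, fun h => hP (h _ rfl)⟩
  · intro P hP
    have hli : LinearIndependent K fun j => (P j).rep := by
      refine GeneralPoints.linearIndependent_of_firstMinor_ne_zero hnd _ fun h => hP ?_
      rintro _ rfl
      exact h
    refine ⟨fun i j hij => hli.injective (congrArg Projectivization.rep hij), fun r hr => ?_⟩
    -- With d = e + 1 and r = q + 1 the truncated subtractions become exact, and m - r is the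
    -- required exponent of M in both cases.
    obtain ⟨e, rfl⟩ := Nat.exists_eq_add_of_le' hd
    obtain ⟨q, rfl⟩ := Nat.exists_eq_add_of_le' hr
    have h1 : (q + 1) * (e + 1) - (q + 1) = (q + 1) * (e + 1 - 1) := by
      rw [Nat.add_sub_cancel, mul_add_one, Nat.add_sub_cancel]
    have h2 : (q + 1) * (e + 1) - (e + 1 - 1) = q * e + (q + 1) := by
      rw [Nat.add_sub_cancel]
      refine Nat.sub_eq_of_eq_add ?_
      ring
    have h3 : q * e + (q + 1) - (q + 1) = (q + 1 - 1) * (e + 1 - 1) := by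
      rw [Nat.add_sub_cancel, Nat.add_sub_cancel, Nat.add_sub_cancel]
    constructor
    · rw [← h1]
      exact GeneralPoints.symbolicPower_pointsIdeal_le hd hn hnd hli (by nlinarith) (by nlinarith)
    · rw [h2, ← h3]
      exact GeneralPoints.symbolicPower_pointsIdeal_le hd hn hnd hli (by nlinarith) (by nlinarith)
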